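/- For real $\alpha,\beta,\gamma\in[0,1)$ and $n\ge 1$, let $r(\alpha,\beta,\gamma,n)=r_0r_1\cdots r_{n-1}$ be the binary word with $r_i=1$ if the fractional part $\{i\alpha\}$ lies in $[\beta,\gamma)$ and $r_i=0$ otherwise, where $[\beta,\gamma)$ is the usual interval if $\beta<\gamma$ and means $[\beta,1)\cup[0,\gamma)$ otherwise. A Sturmian word of length $n$ and slope $\alpha$ is a word $r(\alpha,\beta,\gamma,n)$ with $\beta,\gamma\in[0,1)$ and $\gamma-\beta\equiv\alpha\pmod 1$; let $St(n,\alpha)$ be the set of these words. Let $f_{pairs}(n)$ be the number of ordered pairs $(u,v)$ of distinct words for which there is some $\alpha\in(0,1/2)$ with $u,v\in St(n,\alpha)$. Then for all $n\ge 1$ \[f_{pairs}(n)=n(n+1)+\frac12\sum_{p=3}^{n}\varphi(p)\,(n^2-p^2+n+p),\] where $\varphi$ is Euler's totient function (and the sum is empty for $n<3$). -/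

import Mathlib

open scoped Classical in
/-- The infinite rotation word `r₀r₁⋯` of parameters `α, β, γ` (meant for `α, β, γ ∈ [0,1)`):
`rᵢ = 1` if the fractional part `{iα}` lies in the circular interval `[β, γ)`, and `rᵢ = 0`
otherwise. Here `[β, γ)` is the usual interval if `β < γ`, and `[β, 1) ∪ [0, γ)` otherwise. -/
noncomputable def rotationLetter (α β γ : ℝ) (i : ℕ) : Fin 2 :=
  if Int.fract ((i : ℝ) * α) ∈ (if β < γ then Set.Ico β γ else Set.Ico β 1 ∪ Set.Ico 0 γ)
  then 1 else 0

/-- The prefix `r(α, β, γ, n) = r₀⋯rₙ₋₁` of length `n` of the rotation word of slope `α`. -/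
noncomputable def rotationWord (α β γ : ℝ) (n : ℕ) : Fin n → Fin 2 :=
  fun i => rotationLetter α β γ i

/-- The set `St(n, α)` of Sturmian words of length `n` and slope `α`: the rotation words
`r(α, β, γ, n)` with `β, γ ∈ [0,1)` and `γ - β ≡ α (mod 1)`. -/
def sturmianWords (n : ℕ) (α : ℝ) : Set (Fin n → Fin 2) :=
  {w | ∃ β ∈ Set.Ico (0 : ℝ) 1, ∃ γ ∈ Set.Ico (0 : ℝ) 1,
    (∃ k : ℤ, γ - β = α + k) ∧ w = rotationWord α β γ n}

/-- The set of ordered pairs of distinct Sturmian words of length `n` which have a common slope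
`α ∈ (0, 1/2)`. -/
def sturmianPairs (n : ℕ) : Set ((Fin n → Fin 2) × (Fin n → Fin 2)) :=
  {uv | uv.1 ≠ uv.2 ∧
    ∃ α ∈ Set.Ioo (0 : ℝ) (1 / 2), uv.1 ∈ sturmianWords n α ∧ uv.2 ∈ sturmianWords n α}

/-- The number of such pairs (the ambient type is finite). -/
noncomputable def fPairs (n : ℕ) : ℕ := (sturmianPairs n).ncard

/-! Each pair of distinct words is counted at the slope where it is born. A rotation word codes the
integer parts along a line $y=i\alpha+\rho$, and the slopes of the lines coded by a fixed word form
an open interval. So the common slopes of a pair $u\ne v$ form an open interval too. It misses 0,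
since slope 0 has a single word, and so a pair in `sturmianPairs` has exactly one left endpoint
$x\in[0,1/2)$, where the pair lies in `newPairs n x` (`exists_mem_newPairs`, `disjoint_newPairs`).

Just after any $x\in[0,1)$ there are $n+1$ words; at $x$ itself there are also $n+1$, unless $x$ is
a fraction of reduced denominator $d\le n$, when there are only $d$. Births thus happen only at
Farey fractions, and each brings $n(n+1)-d(d-1)$ pairs. In $[0,1/2)$ there is one such fraction with
$d=1$, none with $d=2$, and $\varphi(d)/2$ for $d\ge3$. -/

open Filter Topology

/-! ### Rotation words as mechanical words -/

/-- The words of length `n` whose letters are the increments of `i ↦ ⌊iα + ρ⌋` for some `ρ`. -/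
def mechanicalWords (n : ℕ) (α : ℝ) : Set (Fin n → Fin 2) :=
  {w | ∃ ρ : ℝ, ∀ i : Fin n, (((w i : Fin 2) : ℕ) : ℤ) =
    ⌊(((i : ℕ) + 1 : ℕ) : ℝ) * α + ρ⌋ - ⌊((i : ℕ) : ℝ) * α + ρ⌋}

/-- The set of slopes of a word. -/
def slopes {n : ℕ} (w : Fin n → Fin 2) : Set ℝ := {α | w ∈ mechanicalWords n α}

lemma floor_sub_of_mem_Ico {x β : ℝ} (hx : x ∈ Set.Ico (0 : ℝ) 1) (hβ : β ∈ Set.Ico (0 : ℝ) 1) :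
    ⌊x - β⌋ = if x < β then -1 else 0 := by
  obtain ⟨h0, h1⟩ := hx
  obtain ⟨h2, h3⟩ := hβ
  split_ifs with h
  · rw [Int.floor_eq_iff]; push_cast; constructor <;> linarith
  · rw [Int.floor_eq_iff]; push_cast; constructor <;> linarith

/-- With $x=\{i\alpha\}$ the right side is $[x<\gamma]-[x<\beta]-k$, the indicator of the circular
interval: $k=0$ when it does not wrap, $k=-1$ when it does. Slope 0 must be excluded: there
$\beta=\gamma$, which by convention means the full circle. -/
lemma rotationLetter_eq {α β γ : ℝ} {k : ℤ} (hα : α ∈ Set.Ioo (0 : ℝ) 1)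
    (hβ : β ∈ Set.Ico (0 : ℝ) 1) (hγ : γ ∈ Set.Ico (0 : ℝ) 1) (hk : γ - β = α + k) (i : ℕ) :
    (((rotationLetter α β γ i : Fin 2) : ℕ) : ℤ) = ⌊(i : ℝ) * α - β⌋ - ⌊(i : ℝ) * α - β - α⌋ := by
  have hx : Int.fract ((i : ℝ) * α) ∈ Set.Ico (0 : ℝ) 1 := ⟨Int.fract_nonneg _, Int.fract_lt_one _⟩
  have e1 : (i : ℝ) * α - β = (Int.fract ((i : ℝ) * α) - β) + (⌊(i : ℝ) * α⌋ : ℤ) := by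
    rw [Int.fract]; ring
  have e2 : (i : ℝ) * α - β - α
      = (Int.fract ((i : ℝ) * α) - γ) + ((⌊(i : ℝ) * α⌋ + k : ℤ) : ℝ) := by
    rw [Int.fract]; push_cast; linarith
  rw [e2, e1, Int.floor_add_intCast, Int.floor_add_intCast, floor_sub_of_mem_Ico hx hβ,
    floor_sub_of_mem_Ico hx hγ, rotationLetter]
  generalize Int.fract ((i : ℝ) * α) = x at *
  obtain ⟨a0, a1⟩ := hα
  obtain ⟨b0, b1⟩ := hβ
  obtain ⟨c0, c1⟩ := hγ
  have k1 : (-2 : ℝ) < k := by linarith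
  have k2 : (k : ℝ) < 1 := by linarith
  have k1' : -2 < k := by exact_mod_cast k1
  have k2' : k < 1 := by exact_mod_cast k2
  obtain rfl | rfl : k = 0 ∨ k = -1 := by omega
  · have hlt : β < γ := by push_cast at hk; linarith
    rcases lt_or_ge x β with h1 | h1 <;> rcases lt_or_ge x γ with h2 | h2
    · simp [hlt, h1, h2, h1.not_ge]
    · linarith
    · simp [hlt, h1, h2, h1.not_gt]
    · simp [hlt, h1.not_gt, h2.not_gt]
  · have hlt : ¬ β < γ := by push_cast at hk; linarith
    rcases lt_or_ge x β with h1 | h1 <;> rcases lt_or_ge x γ with h2 | h2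
    · simp [hlt, h1, h2, hx.1]
    · simp [hlt, h1, h1.not_ge, h2.not_gt]
      ring
    · linarith
    · simp [hlt, h1, h1.not_gt, h2.not_gt, hx.2]

lemma sturmianWords_eq_mechanicalWords {n : ℕ} {α : ℝ} (hα : α ∈ Set.Ioo (0 : ℝ) 1) :
    sturmianWords n α = mechanicalWords n α := by
  ext w
  constructor
  · rintro ⟨β, hβ, γ, hγ, ⟨k, hk⟩, rfl⟩
    refine ⟨-β - α, fun i => ?_⟩
    rw [rotationWord, rotationLetter_eq hα hβ hγ hk]
    congr 2
    · push_cast; ring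
    · ring
  · rintro ⟨ρ, hρ⟩
    have hβ : Int.fract (-ρ - α) ∈ Set.Ico (0 : ℝ) 1 := ⟨Int.fract_nonneg _, Int.fract_lt_one _⟩
    have hγ : Int.fract (-ρ) ∈ Set.Ico (0 : ℝ) 1 := ⟨Int.fract_nonneg _, Int.fract_lt_one _⟩
    have hk : Int.fract (-ρ) - Int.fract (-ρ - α) = α + ((⌊-ρ - α⌋ - ⌊-ρ⌋ : ℤ) : ℝ) := by
      simp only [Int.fract]; push_cast; ring
    refine ⟨_, hβ, _, hγ, ⟨_, hk⟩, ?_⟩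
    ext i
    have h := rotationLetter_eq hα hβ hγ hk i
    have h' := hρ i
    have e1 : ((i : ℕ) : ℝ) * α - Int.fract (-ρ - α)
        = (((i : ℕ) + 1 : ℕ) : ℝ) * α + ρ + (⌊-ρ - α⌋ : ℤ) := by
      rw [Int.fract]; push_cast; ring
    have e2 : ((i : ℕ) : ℝ) * α - Int.fract (-ρ - α) - α
        = ((i : ℕ) : ℝ) * α + ρ + (⌊-ρ - α⌋ : ℤ) := by
      rw [Int.fract]; ring
    rw [e2, e1, Int.floor_add_intCast, Int.floor_add_intCast] at h
    have : (((w i : Fin 2) : ℕ) : ℤ)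
        = ((rotationLetter α (Int.fract (-ρ - α)) (Int.fract (-ρ)) i : Fin 2) : ℕ) := by
      rw [h, h']; ring
    exact_mod_cast this

/-! ### The slopes of a word form an open interval -/

/-- A word has slope `α` iff its height function stays strictly within distance one below some
line of slope `α`. -/
lemma exists_height {n : ℕ} (w : Fin n → Fin 2) : ∃ m : ℕ → ℤ, ∀ α : ℝ, α ∈ slopes w ↔
    ∃ ρ : ℝ, ∀ j ∈ Finset.range (n + 1), (m j : ℝ) < j * α + ρ ∧ (j : ℝ) * α + ρ < m j + 1 := by
  obtain ⟨m, m0, hm⟩ : ∃ m : ℕ → ℤ, m 0 = 0 ∧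
      ∀ i : Fin n, (((w i : Fin 2) : ℕ) : ℤ) = m (i + 1) - m i := by
    refine ⟨fun j => ∑ i ∈ Finset.range j,
      if h : i < n then (((w ⟨i, h⟩ : Fin 2) : ℕ) : ℤ) else 0, by simp, fun i => ?_⟩
    simp [Finset.sum_range_succ]
  refine ⟨m, fun α => ⟨?_, ?_⟩⟩
  · rintro ⟨ρ, hρ⟩
    have key : ∀ j : ℕ, j ≤ n → ⌊(j : ℝ) * α + Int.fract ρ⌋ = m j := by
      intro j
      induction j with
      | zero => intro _; simp [m0]
      | succ j ih =>
        intro hj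
        have h1 := ih (by omega)
        have h2 := hρ ⟨j, hj⟩
        have h3 := hm ⟨j, hj⟩
        have e : ∀ t : ℝ, ⌊t + Int.fract ρ⌋ = ⌊t + ρ⌋ - ⌊ρ⌋ := by
          intro t
          rw [← Int.floor_sub_intCast, Int.fract]
          congr 1
          ring
        rw [e] at h1 ⊢
        simp only at h2 h3
        omega
    -- The floor bounds are strict only from above. Finitely many strict inequalities leave room to
    -- raise the line slightly, which makes the lower bounds strict too; openness rests on this.
    have hδ : ∀ᶠ δ in 𝓝[>] (0 : ℝ), ∀ j ∈ Finset.range (n + 1),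
        (j : ℝ) * α + Int.fract ρ + δ < m j + 1 := by
      rw [Finset.eventually_all]
      intro j hj
      refine Filter.Eventually.filter_mono nhdsWithin_le_nhds ?_
      have hlt : (j : ℝ) * α + Int.fract ρ + 0 < m j + 1 := by
        rw [← key j (by simpa [Nat.lt_succ_iff] using hj), add_zero]
        exact Int.lt_floor_add_one _
      exact (ContinuousAt.eventually_lt (f := fun δ : ℝ => (j : ℝ) * α + Int.fract ρ + δ)
        (by fun_prop) continuousAt_const hlt)
    obtain ⟨δ, hδ, hpos⟩ := (hδ.and self_mem_nhdsWithin).exists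
    refine ⟨Int.fract ρ + δ, fun j hj => ⟨?_, ?_⟩⟩
    · have := Int.floor_le ((j : ℝ) * α + Int.fract ρ)
      rw [key j (by simpa [Nat.lt_succ_iff] using hj)] at this
      have : (0 : ℝ) < δ := hpos
      linarith
    · have := hδ j hj
      linarith
  · rintro ⟨ρ, hρ⟩
    refine ⟨ρ, fun i => ?_⟩
    have key : ∀ j ∈ Finset.range (n + 1), ⌊(j : ℝ) * α + ρ⌋ = m j := fun j hj => by
      rw [Int.floor_eq_iff]
      exact ⟨(hρ j hj).1.le, (hρ j hj).2⟩
    rw [key _ (by simp), key _ (by simp), hm]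

lemma isOpen_slopes {n : ℕ} (w : Fin n → Fin 2) : IsOpen (slopes w) := by
  obtain ⟨m, hm⟩ := exists_height w
  have : slopes w = Prod.fst '' (⋂ j ∈ Finset.range (n + 1),
      {x : ℝ × ℝ | (m j : ℝ) < j * x.1 + x.2 ∧ (j : ℝ) * x.1 + x.2 < m j + 1}) := by
    ext α
    simp [hm]
  rw [this]
  refine isOpenMap_fst _ (isOpen_biInter_finset fun j _ => ?_)
  have hc : Continuous fun x : ℝ × ℝ => (j : ℝ) * x.1 + x.2 := by fun_prop
  exact (isOpen_lt continuous_const hc).inter (isOpen_lt hc continuous_const)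

/-- A convex combination of two admissible lines is admissible. -/
lemma ordConnected_slopes {n : ℕ} (w : Fin n → Fin 2) : (slopes w).OrdConnected := by
  obtain ⟨m, hm⟩ := exists_height w
  rw [← convex_iff_ordConnected]
  intro x hx y hy a b ha hb hab
  rw [hm] at hx hy ⊢
  obtain ⟨ρ, hρ⟩ := hx
  obtain ⟨σ, hσ⟩ := hy
  refine ⟨a * ρ + b * σ, fun j hj => ?_⟩
  obtain ⟨h1, h2⟩ := hρ j hj
  obtain ⟨h3, h4⟩ := hσ j hj
  have e : (j : ℝ) * (a • x + b • y) + (a * ρ + b * σ)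
      = a • (j * x + ρ) + b • (j * y + σ) := by simp only [smul_eq_mul]; ring
  have := (convex_Ioo (m j : ℝ) (m j + 1)) ⟨h1, h2⟩ ⟨h3, h4⟩ ha hb hab
  rw [e]
  exact this

/-! ### Counting the words of a given slope -/

/-- The mechanical word of slope `α` whose line passes through the lattice point at abscissa `k`. -/
noncomputable def latticeWord (n : ℕ) (α : ℝ) (k : ℕ) : Fin n → Fin 2 := fun i =>
  if ⌊(((i : ℕ) + 1 : ℕ) : ℝ) * α + -(k * α)⌋ - ⌊((i : ℕ) : ℝ) * α + -(k * α)⌋ = 1 then 1 else 0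

lemma latticeWord_apply {n : ℕ} {α : ℝ} (h0 : 0 ≤ α) (h1 : α < 1) (k : ℕ) (i : Fin n) :
    (((latticeWord n α k i : Fin 2) : ℕ) : ℤ) =
      ⌊(((i : ℕ) + 1 : ℕ) : ℝ) * α + -(k * α)⌋ - ⌊((i : ℕ) : ℝ) * α + -(k * α)⌋ := by
  rw [latticeWord]
  have e : (((i : ℕ) + 1 : ℕ) : ℝ) * α + -(k * α) = ((i : ℕ) : ℝ) * α + -(k * α) + α := by
    push_cast; ring
  rw [e]
  generalize ((i : ℕ) : ℝ) * α + -(k * α) = t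
  have a1 : ⌊t⌋ ≤ ⌊t + α⌋ := Int.floor_mono (by linarith)
  have a2 : ⌊t + α⌋ ≤ ⌊t⌋ + 1 := by
    rw [← Int.floor_add_one]
    exact Int.floor_mono (by linarith)
  split_ifs with h
  · simp [h]
  · simp only [Fin.val_zero, Nat.cast_zero]
    omega

/-- Lowering a line until it first meets a lattice point changes no floor; the point is met at the
abscissa $k$ minimising $\{j\alpha+\rho\}$. -/
lemma mechanicalWords_eq_image {n : ℕ} {α : ℝ} (h0 : 0 ≤ α) (h1 : α < 1) :
    mechanicalWords n α = latticeWord n α '' (Finset.range (n + 1) : Finset ℕ) := by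
  ext w
  constructor
  · rintro ⟨ρ, hρ⟩
    obtain ⟨k, hk, hmin⟩ := Finset.exists_min_image (Finset.range (n + 1))
      (fun j : ℕ => Int.fract ((j : ℝ) * α + ρ)) ⟨0, by simp⟩
    refine ⟨k, hk, ?_⟩
    have key : ∀ j ∈ Finset.range (n + 1),
        ⌊(j : ℝ) * α + -(k * α)⌋ = ⌊(j : ℝ) * α + ρ⌋ - ⌊(k : ℝ) * α + ρ⌋ := by
      intro j hj
      have h := hmin j hj
      have hlt := Int.fract_lt_one ((j : ℝ) * α + ρ)
      have hn := Int.fract_nonneg ((k : ℝ) * α + ρ)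
      rw [Int.floor_eq_iff]
      simp only [Int.fract] at h hlt hn
      push_cast
      constructor <;> linarith
    ext i
    have h2 := latticeWord_apply (n := n) h0 h1 k i
    rw [key _ (by simp), key _ (by simp)] at h2
    have h3 := hρ i
    have : (((latticeWord n α k i : Fin 2) : ℕ) : ℤ) = ((w i : Fin 2) : ℕ) := by
      rw [h2, h3]; ring
    exact_mod_cast this
  · rintro ⟨k, -, rfl⟩
    exact ⟨-(k * α), latticeWord_apply h0 h1 k⟩

/-- Equal words force the floors along the two lines to differ by a constant. Comparing $j=k$ with
$j=l$ gives $\lfloor t\rfloor=-\lfloor -t\rfloor$ for $t=(l-k)\alpha$, so $t$ is an integer. -/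
lemma exists_int_of_latticeWord_eq {n : ℕ} {α : ℝ} (h0 : 0 ≤ α) (h1 : α < 1) {k l : ℕ}
    (hk : k ≤ n) (hl : l ≤ n) (h : latticeWord n α k = latticeWord n α l) :
    ∃ z : ℤ, (l : ℝ) * α - k * α = z := by
  have key : ∀ j : ℕ, j ≤ n → ⌊(j : ℝ) * α + -(k * α)⌋ - ⌊(j : ℝ) * α + -(l * α)⌋
      = ⌊-((k : ℝ) * α)⌋ - ⌊-((l : ℝ) * α)⌋ := by
    intro j
    induction j with
    | zero => intro _; simp
    | succ j ih =>
      intro hj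
      have e1 := latticeWord_apply (n := n) h0 h1 k ⟨j, hj⟩
      have e2 := latticeWord_apply (n := n) h0 h1 l ⟨j, hj⟩
      rw [h] at e1
      have := ih (by omega)
      simp only at e1 e2
      omega
  have e1 := key k hk
  have e2 := key l hl
  rw [← e1] at e2
  have z1 : (k : ℝ) * α + -(k * α) = 0 := by ring
  have z2 : (l : ℝ) * α + -(l * α) = 0 := by ring
  rw [z1, z2, Int.floor_zero] at e2
  refine ⟨⌊(l : ℝ) * α + -(k * α)⌋, ?_⟩
  have a1 := Int.floor_le ((l : ℝ) * α + -(k * α))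
  have a2 := Int.floor_le ((k : ℝ) * α + -(l * α))
  have e3 : (⌊(l : ℝ) * α + -(k * α)⌋ : ℝ) = -(⌊(k : ℝ) * α + -(l * α)⌋ : ℝ) := by
    have : ⌊(l : ℝ) * α + -(k * α)⌋ = -⌊(k : ℝ) * α + -(l * α)⌋ := by omega
    exact_mod_cast this
  linarith

lemma latticeWord_eq_of_int {n : ℕ} {α : ℝ} {k l : ℕ} {z : ℤ}
    (h : (l : ℝ) * α - k * α = z) : latticeWord n α k = latticeWord n α l := by
  have e : ∀ t : ℝ, ⌊t + -(k * α)⌋ = ⌊t + -(l * α)⌋ + z := by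
    intro t
    rw [← Int.floor_add_intCast, ← h]
    congr 1
    ring
  ext i
  simp only [latticeWord, e, add_sub_add_right_eq_sub]

lemma ncard_mechanicalWords_of_forall_ne {n : ℕ} {α : ℝ} (h0 : 0 ≤ α) (h1 : α < 1)
    (h : ∀ q : ℚ, q.den ≤ n → α ≠ q) : (mechanicalWords n α).ncard = n + 1 := by
  have main : ∀ k l : ℕ, k < l → l ≤ n → latticeWord n α k ≠ latticeWord n α l := by
    intro k l hkl hl he
    obtain ⟨z, hz⟩ := exists_int_of_latticeWord_eq h0 h1 (by omega) hl he
    have hpos : (0 : ℝ) < (l : ℝ) - k := by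
      have : (k : ℝ) < l := by exact_mod_cast hkl
      linarith
    refine h (Rat.divInt z ((l - k : ℕ) : ℤ)) ?_ ?_
    · have hd := Rat.den_dvd z ((l - k : ℕ) : ℤ)
      have hd' : (Rat.divInt z ((l - k : ℕ) : ℤ)).den ∣ l - k := by exact_mod_cast hd
      have := Nat.le_of_dvd (by omega) hd'
      omega
    · rw [Rat.divInt_eq_div]
      push_cast [Nat.cast_sub hkl.le]
      rw [eq_div_iff hpos.ne', ← hz]
      ring
  rw [mechanicalWords_eq_image h0 h1, Set.InjOn.ncard_image, Set.ncard_coe_finset,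
    Finset.card_range]
  intro k hk l hl he
  simp only [Finset.coe_range, Set.mem_Iio] at hk hl
  rcases lt_trichotomy k l with hlt | heq | hlt
  · exact absurd he (main k l hlt (by omega))
  · exact heq
  · exact absurd he.symm (main l k hlt (by omega))

/-- The lattice word depends exactly on $k$ modulo the denominator, and $d\le n$ ensures that every
residue occurs among $0,\dots,n$. -/
lemma ncard_mechanicalWords_ratCast {n : ℕ} {q : ℚ} (h0 : 0 ≤ q) (h1 : q < 1)
    (hq : q.den ≤ n) : (mechanicalWords n (q : ℝ)).ncard = q.den := by
  have h0' : (0 : ℝ) ≤ q := by exact_mod_cast h0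
  have h1' : (q : ℝ) < 1 := by exact_mod_cast h1
  have hqd : (q : ℝ) * q.den = q.num := by exact_mod_cast Rat.mul_den_eq_num q
  have himg : latticeWord n (q : ℝ) '' (Finset.range (n + 1) : Finset ℕ)
      = latticeWord n (q : ℝ) '' (Finset.range q.den : Finset ℕ) := by
    apply Set.Subset.antisymm
    · rintro _ ⟨k, -, rfl⟩
      refine ⟨k % q.den, by simpa using Nat.mod_lt _ q.den_pos, ?_⟩
      refine latticeWord_eq_of_int (z := ((k / q.den : ℕ) : ℤ) * q.num) ?_
      have : (k : ℝ) = ((k % q.den : ℕ) : ℝ) + q.den * ((k / q.den : ℕ) : ℝ) := by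
        exact_mod_cast (Nat.mod_add_div k q.den).symm
      rw [Int.cast_mul, Int.cast_natCast, ← hqd]
      linear_combination (q : ℝ) * this
    · refine Set.image_mono ?_
      intro k hk
      simp only [Finset.coe_range, Set.mem_Iio] at hk ⊢
      omega
  have main : ∀ k l : ℕ, k < l → l < q.den →
      latticeWord n (q : ℝ) k ≠ latticeWord n (q : ℝ) l := by
    intro k l hkl hl he
    obtain ⟨z, hz⟩ := exists_int_of_latticeWord_eq h0' h1' (by omega) (by omega) he
    have hz' : ((l - k : ℕ) : ℤ) * q.num = z * q.den := by
      have : ((l - k : ℕ) : ℝ) * q.num = z * q.den := by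
        rw [← hz, ← hqd]
        push_cast [Nat.cast_sub hkl.le]
        ring
      exact_mod_cast this
    have hdvd : (q.den : ℤ) ∣ ((l - k : ℕ) : ℤ) * q.num := ⟨z, by rw [hz']; ring⟩
    have hcop : IsCoprime (q.den : ℤ) q.num := by
      rw [Int.isCoprime_iff_nat_coprime]
      simpa using q.reduced.symm
    have := hcop.dvd_of_dvd_mul_right hdvd
    have h2 : q.den ∣ l - k := by exact_mod_cast this
    have := Nat.le_of_dvd (by omega) h2
    omega
  rw [mechanicalWords_eq_image h0' h1', himg, Set.InjOn.ncard_image, Set.ncard_coe_finset,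
    Finset.card_range]
  intro k hk l hl he
  simp only [Finset.coe_range, Set.mem_Iio] at hk hl
  rcases lt_trichotomy k l with hlt | heq | hlt
  · exact absurd he (main k l hlt hl)
  · exact heq
  · exact absurd he.symm (main l k hlt hk)

/-! ### Words and pairs born just after a slope -/

/-- The words which are mechanical for all slopes in a right neighbourhood of `x`. -/
def rightWords (n : ℕ) (x : ℝ) : Set (Fin n → Fin 2) :=
  {w | ∀ᶠ α in 𝓝[>] x, w ∈ mechanicalWords n α}

lemma mechanicalWords_subset_rightWords (n : ℕ) (x : ℝ) :
    mechanicalWords n x ⊆ rightWords n x := fun w hw =>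
  Filter.Eventually.filter_mono nhdsWithin_le_nhds ((isOpen_slopes w).mem_nhds hw)

lemma eventually_mechanicalWords_eq (n : ℕ) (x : ℝ) :
    ∀ᶠ α in 𝓝[>] x, mechanicalWords n α = rightWords n x := by
  have h : ∀ᶠ α in 𝓝[>] x, ∀ w : Fin n → Fin 2,
      (w ∈ mechanicalWords n α ↔ w ∈ rightWords n x) := by
    rw [Filter.eventually_all]
    intro w
    by_cases hw : w ∈ rightWords n x
    · filter_upwards [hw] with α hα
      exact iff_of_true hα hw
    -- No oscillation is possible: a word occurring at slopes arbitrarily close to $x$ on the right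
    -- occurs, by convexity, at all slopes in between.
    · by_cases hex : ∃ᶠ α in 𝓝[>] x, w ∈ mechanicalWords n α
      · exfalso
        apply hw
        obtain ⟨β, hβ, hxβ⟩ := (hex.and_eventually self_mem_nhdsWithin).exists
        have hIoo : ∀ᶠ α in 𝓝[>] x, α ∈ Set.Ioo x β := Ioo_mem_nhdsGT hxβ
        filter_upwards [hIoo] with α hα
        have hI : ∀ᶠ t in 𝓝[>] x, t ∈ Set.Ioo x α := Ioo_mem_nhdsGT hα.1
        obtain ⟨γ, hγ, hγα⟩ := (hex.and_eventually hI).exists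
        exact (ordConnected_slopes w).out hγ hβ ⟨hγα.2.le, hα.2.le⟩
      · rw [Filter.not_frequently] at hex
        filter_upwards [hex] with α hα
        exact iff_of_false hα hw
  filter_upwards [h] with α hα
  exact Set.ext hα

/-- Since the set of words is constant just after $x$, it can be counted at an irrational slope. -/
lemma ncard_rightWords {n : ℕ} {x : ℝ} (h0 : 0 ≤ x) (h1 : x < 1) :
    (rightWords n x).ncard = n + 1 := by
  obtain ⟨b, hb, hsub⟩ := mem_nhdsGT_iff_exists_Ioo_subset.1 (eventually_mechanicalWords_eq n x)
  obtain ⟨α, hα, hx, hlt⟩ := exists_irrational_btwn (lt_min (show x < b from hb) h1)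
  rw [← show mechanicalWords n α = rightWords n x from
    hsub ⟨hx, hlt.trans_le (min_le_left _ _)⟩]
  refine ncard_mechanicalWords_of_forall_ne (h0.trans hx.le) (hlt.trans_le (min_le_right _ _)) ?_
  rintro q - rfl
  exact hα ⟨q, rfl⟩

/-- The ordered pairs of distinct words which become mechanical of a common slope just after `x`. -/
def newPairs (n : ℕ) (x : ℝ) : Set ((Fin n → Fin 2) × (Fin n → Fin 2)) :=
  (rightWords n x).offDiag \ (mechanicalWords n x).offDiag

lemma Set.ncard_offDiag_of_finite {β : Type*} {s : Set β} (hs : s.Finite) :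
    s.offDiag.ncard = s.ncard * s.ncard - s.ncard := by
  classical
  lift s to Finset β using hs
  rw [← Finset.coe_offDiag, Set.ncard_coe_finset, Set.ncard_coe_finset, Finset.offDiag_card]

lemma ncard_newPairs {n : ℕ} {q : ℚ} (h0 : 0 ≤ q) (h1 : q < 1) (hq : q.den ≤ n) :
    (((newPairs n (q : ℝ)).ncard : ℕ) : ℚ) = (n + 1) * n - q.den * (q.den - 1) := by
  have h0' : (0 : ℝ) ≤ q := by exact_mod_cast h0
  have h1' : (q : ℝ) < 1 := by exact_mod_cast h1
  have hsub : (mechanicalWords n (q : ℝ)).offDiag ⊆ (rightWords n (q : ℝ)).offDiag :=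
    Set.offDiag_mono (mechanicalWords_subset_rightWords n q)
  have h := Set.ncard_sdiff_add_ncard_of_subset hsub
  rw [Set.ncard_offDiag_of_finite (Set.toFinite _), Set.ncard_offDiag_of_finite (Set.toFinite _),
    ncard_rightWords h0' h1', ncard_mechanicalWords_ratCast h0 h1 hq] at h
  have e1 : (n + 1) * (n + 1) - (n + 1) = (n + 1) * n := by
    rw [Nat.mul_succ]; omega
  have e2 : q.den * q.den - q.den + q.den = q.den * q.den :=
    Nat.sub_add_cancel (Nat.le_mul_self _)
  rw [e1] at h
  have h' : (((newPairs n (q : ℝ)).ncard : ℕ) : ℚ) + ((q.den * q.den - q.den : ℕ) : ℚ)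
      = (n + 1) * n := by exact_mod_cast h
  have e2' : ((q.den * q.den - q.den : ℕ) : ℚ) + q.den = q.den * q.den := by exact_mod_cast e2
  linear_combination h' - e2'

lemma mem_mechanicalWords_of_mem_rightWords {n : ℕ} {x y : ℝ} (hxy : x < y) {w : Fin n → Fin 2}
    (hx : w ∈ rightWords n x) (hy : w ∈ rightWords n y) : w ∈ mechanicalWords n y := by
  have hx' : ∀ᶠ α in 𝓝[>] x, w ∈ mechanicalWords n α := hx
  have hy' : ∀ᶠ α in 𝓝[>] y, w ∈ mechanicalWords n α := hy
  have hI : ∀ᶠ t in 𝓝[>] x, t ∈ Set.Ioo x y := Ioo_mem_nhdsGT hxy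
  obtain ⟨s, hs, hsy⟩ := (hx'.and hI).exists
  obtain ⟨t, ht, hty⟩ := (hy'.and self_mem_nhdsWithin).exists
  exact (ordConnected_slopes w).out hs ht ⟨hsy.2.le, le_of_lt hty⟩

/-- A pair born at $x$ and present just after $y>x$ is already present at $y$, so it is not born
again there. -/
lemma disjoint_newPairs {n : ℕ} {x y : ℝ} (hxy : x < y) :
    Disjoint (newPairs n x) (newPairs n y) := by
  rw [Set.disjoint_left]
  rintro ⟨u, v⟩ ⟨⟨hu, hv, huv⟩, -⟩ ⟨⟨hu', hv', -⟩, hn⟩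
  exact hn ⟨mem_mechanicalWords_of_mem_rightWords hxy hu hu',
    mem_mechanicalWords_of_mem_rightWords hxy hv hv', huv⟩

lemma newPairs_subset_sturmianPairs {n : ℕ} {x : ℝ} (h0 : 0 ≤ x) (h1 : x < 1 / 2) :
    newPairs n x ⊆ sturmianPairs n := by
  rintro ⟨u, v⟩ ⟨⟨hu, hv, huv⟩, -⟩
  have hu' : ∀ᶠ α in 𝓝[>] x, u ∈ mechanicalWords n α := hu
  have hv' : ∀ᶠ α in 𝓝[>] x, v ∈ mechanicalWords n α := hv
  have hI : ∀ᶠ t in 𝓝[>] x, t ∈ Set.Ioo x (1 / 2) := Ioo_mem_nhdsGT h1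
  obtain ⟨α, ⟨hα, hα'⟩, hx⟩ := ((hu'.and hv').and hI).exists
  refine ⟨huv, α, ⟨h0.trans_lt hx.1, hx.2⟩, ?_⟩
  rw [sturmianWords_eq_mechanicalWords ⟨h0.trans_lt hx.1, hx.2.trans (by norm_num)⟩]
  exact ⟨hα, hα'⟩

/-- The birth slope is the infimum of the nonnegative common slopes. -/
lemma exists_mem_newPairs {n : ℕ} (hn : 1 ≤ n) {p : (Fin n → Fin 2) × (Fin n → Fin 2)}
    (hp : p ∈ sturmianPairs n) :
    ∃ q : ℚ, 0 ≤ q ∧ q < 1 / 2 ∧ q.den ≤ n ∧ p ∈ newPairs n q := by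
  obtain ⟨u, v⟩ := p
  obtain ⟨huv, α, hα, hu, hv⟩ := hp
  simp only at huv hu hv
  rw [sturmianWords_eq_mechanicalWords ⟨hα.1, hα.2.trans (by norm_num)⟩] at hu hv
  set A : Set ℝ := slopes u ∩ slopes v with hA
  have hAo : IsOpen A := (isOpen_slopes u).inter (isOpen_slopes v)
  have hAc : A.OrdConnected := (ordConnected_slopes u).inter (ordConnected_slopes v)
  have h0A : (0 : ℝ) ∉ A := by
    rintro ⟨h0u, h0v⟩
    have h1 := ncard_mechanicalWords_ratCast (n := n) (q := 0) le_rfl one_pos (by simpa using hn)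
    rw [Rat.cast_zero, Rat.den_zero, Set.ncard_eq_one] at h1
    obtain ⟨w, hw⟩ := h1
    have h0u' : u ∈ mechanicalWords n 0 := h0u
    have h0v' : v ∈ mechanicalWords n 0 := h0v
    rw [hw] at h0u' h0v'
    exact huv (h0u'.trans h0v'.symm)
  set B : Set ℝ := A ∩ Set.Ici 0
  have hαB : α ∈ B := ⟨⟨hu, hv⟩, hα.1.le⟩
  have hbdd : BddBelow B := ⟨0, fun t ht => ht.2⟩
  set x := sInf B with hx
  have hx0 : 0 ≤ x := le_csInf ⟨α, hαB⟩ fun t ht => ht.2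
  have hxα : x ≤ α := csInf_le hbdd hαB
  -- If the infimum were itself a common slope it would be positive, and openness would give a
  -- smaller one.
  have hxA : x ∉ A := by
    intro hxA
    have hpos : 0 < x := lt_of_le_of_ne hx0 (by rintro h; exact h0A (h ▸ hxA))
    have h1 : ∀ᶠ t in 𝓝[<] x, t ∈ A := Filter.Eventually.filter_mono nhdsWithin_le_nhds
      (hAo.mem_nhds hxA)
    have h2 : ∀ᶠ t in 𝓝[<] x, t ∈ Set.Ioo 0 x := Ioo_mem_nhdsLT hpos
    obtain ⟨t, htA, ht⟩ := (h1.and h2).exists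
    exact absurd (csInf_le hbdd ⟨htA, ht.1.le⟩) (not_le.2 ht.2)
  have hlt : x < α := lt_of_le_of_ne hxα fun h => hxA (h ▸ hαB.1)
  have hright : ∀ t ∈ Set.Ioo x α, t ∈ A := by
    intro t ht
    obtain ⟨s, hs, hst⟩ := exists_lt_of_csInf_lt ⟨α, hαB⟩ ht.1
    exact hAc.out hs.1 hαB.1 ⟨hst.le, ht.2.le⟩
  have hmem : ((u, v) : (Fin n → Fin 2) × (Fin n → Fin 2)) ∈ newPairs n x := by
    have hI : ∀ᶠ t in 𝓝[>] x, t ∈ Set.Ioo x α := Ioo_mem_nhdsGT hlt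
    refine ⟨⟨?_, ?_, huv⟩, fun h => hxA ⟨h.1, h.2.1⟩⟩
    · filter_upwards [hI] with t ht
      exact (hright t ht).1
    · filter_upwards [hI] with t ht
      exact (hright t ht).2
  have hx1 : x < 1 / 2 := hlt.trans hα.2
  -- Otherwise all $n+1$ words of the right neighbourhood already occur at $x$, and no pair is born
  -- there.
  obtain ⟨q, hq, hxq⟩ : ∃ q : ℚ, q.den ≤ n ∧ x = q := by
    by_contra! hcon
    have h1 := ncard_mechanicalWords_of_forall_ne hx0 (hx1.trans (by norm_num)) hcon
    have h2 := ncard_rightWords (n := n) hx0 (hx1.trans (by norm_num))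
    have h3 := Set.eq_of_subset_of_ncard_le (mechanicalWords_subset_rightWords n x)
      (by rw [h1, h2]) (Set.toFinite _)
    have := hmem.2
    rw [h3] at this
    exact this hmem.1
  rw [hxq] at hx0 hx1 hmem
  refine ⟨q, by exact_mod_cast hx0, ?_, hq, hmem⟩
  have : (q : ℝ) < ((1 / 2 : ℚ) : ℝ) := by push_cast; exact hx1
  exact_mod_cast this

/-- The numerators of the reduced fractions in `[0, 1/2)` with denominator `p`. -/
def fareyNumerators (p : ℕ) : Finset ℕ := {a ∈ Finset.range p | p.Coprime a ∧ 2 * a < p}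

/-- The reflection $a\mapsto p-a$ swaps the two halves of the residues coprime to $p$; for $p\ge3$
neither 0 nor $p/2$ is coprime to $p$. -/
lemma card_fareyNumerators {p : ℕ} (hp : 3 ≤ p) :
    2 * (fareyNumerators p).card = p.totient := by
  have hsplit : p.totient = (fareyNumerators p).card +
      ({a ∈ Finset.range p | p.Coprime a ∧ ¬ 2 * a < p} : Finset ℕ).card := by
    rw [Nat.totient, ← Finset.card_filter_add_card_filter_not (fun a => 2 * a < p),
      Finset.filter_filter, Finset.filter_filter, fareyNumerators]
  have hbij : (fareyNumerators p).card =
      ({a ∈ Finset.range p | p.Coprime a ∧ ¬ 2 * a < p} : Finset ℕ).card := by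
    have hne : ∀ a, p.Coprime a → a ≠ 0 ∧ 2 * a ≠ p := by
      intro a ha
      refine ⟨?_, ?_⟩
      · rintro rfl
        rw [Nat.coprime_zero_right] at ha
        omega
      · rintro rfl
        have := Nat.Coprime.eq_one_of_dvd ha.symm (Dvd.intro_left 2 rfl)
        omega
    refine Finset.card_bij' (fun a _ => p - a) (fun a _ => p - a) ?_ ?_ ?_ ?_ <;>
    intro a ha <;> simp only [fareyNumerators, Finset.mem_filter, Finset.mem_range] at ha ⊢ <;>
    have := hne a ha.2.1
    · exact ⟨by omega, (Nat.coprime_self_sub_right ha.1.le).2 ha.2.1, by omega⟩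
    · exact ⟨by omega, (Nat.coprime_self_sub_right ha.1.le).2 ha.2.1, by omega⟩
    · omega
    · omega
  omega

/-- The reduced fractions in `[0, 1/2)` with denominator at most `n`, as pairs of a denominator and
a numerator. -/
def fareyFractions (n : ℕ) : Finset (Σ _ : ℕ, ℕ) := (Finset.Icc 1 n).sigma fareyNumerators

lemma mem_fareyFractions {n : ℕ} {x : Σ _ : ℕ, ℕ} (hx : x ∈ fareyFractions n) :
    0 ≤ (x.2 / x.1 : ℚ) ∧ (x.2 / x.1 : ℚ) < 1 / 2 ∧ (x.2 / x.1 : ℚ).den = x.1 ∧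
      (x.2 / x.1 : ℚ).num = x.2 ∧ x.1 ≤ n := by
  obtain ⟨p, a⟩ := x
  simp only [fareyFractions, fareyNumerators, Finset.mem_sigma, Finset.mem_Icc,
    Finset.mem_filter, Finset.mem_range] at hx ⊢
  obtain ⟨⟨h1, h2⟩, h3, h4, h5⟩ := hx
  have hp : (0 : ℚ) < p := by exact_mod_cast h1
  refine ⟨by positivity, ?_, ?_, ?_, h2⟩
  · rw [div_lt_div_iff₀ hp two_pos]
    have : (2 : ℚ) * a < p := by exact_mod_cast h5
    linarith
  · have := Rat.den_div_eq_of_coprime (a := (a : ℤ)) (b := (p : ℤ)) (by exact_mod_cast h1)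
      (by simpa using h4.symm)
    simp only [Int.cast_natCast] at this
    exact_mod_cast this
  · have := Rat.num_div_eq_of_coprime (a := (a : ℤ)) (b := (p : ℤ)) (by exact_mod_cast h1)
      (by simpa using h4.symm)
    simpa using this

lemma exists_mem_fareyFractions {n : ℕ} {q : ℚ} (h0 : 0 ≤ q) (h1 : q < 1 / 2) (hq : q.den ≤ n) :
    ∃ x ∈ fareyFractions n, (x.2 / x.1 : ℚ) = q := by
  obtain ⟨a, ha⟩ := Int.eq_ofNat_of_zero_le (Rat.num_nonneg.2 h0)
  have hqa : (a : ℚ) / q.den = q := by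
    conv_rhs => rw [← Rat.num_div_den q, ha]
    simp
  have hpos := q.den_pos
  have hlt : 2 * a < q.den := by
    have hp : (0 : ℚ) < q.den := by exact_mod_cast hpos
    rw [← hqa, div_lt_div_iff₀ hp two_pos] at h1
    have : a * 2 < 1 * q.den := by exact_mod_cast h1
    omega
  refine ⟨⟨q.den, a⟩, ?_, hqa⟩
  simp only [fareyFractions, fareyNumerators, Finset.mem_sigma, Finset.mem_Icc,
    Finset.mem_filter, Finset.mem_range]
  refine ⟨⟨hpos, hq⟩, by omega, ?_, hlt⟩
  have := q.reduced
  rw [ha] at this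
  simpa using this.symm

/-! ### Summation over birth slopes -/

lemma fPairs_eq_sum {n : ℕ} (hn : 1 ≤ n) :
    fPairs n = ∑ x ∈ fareyFractions n, (newPairs n ((x.2 / x.1 : ℚ) : ℝ)).ncard := by
  have hU : sturmianPairs n = ⋃ x ∈ (fareyFractions n : Set (Σ _ : ℕ, ℕ)),
      newPairs n ((x.2 / x.1 : ℚ) : ℝ) := by
    apply Set.Subset.antisymm
    · intro P hP
      obtain ⟨q, h0, h1, hq, hmem⟩ := exists_mem_newPairs hn hP
      obtain ⟨x, hx, rfl⟩ := exists_mem_fareyFractions h0 h1 hq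
      exact Set.mem_biUnion hx hmem
    · refine Set.iUnion₂_subset fun x hx => ?_
      obtain ⟨h0, h1, -⟩ := mem_fareyFractions hx
      refine newPairs_subset_sturmianPairs (by exact_mod_cast h0) ?_
      have : ((x.2 / x.1 : ℚ) : ℝ) < ((1 / 2 : ℚ) : ℝ) := by exact_mod_cast h1
      simpa using this
  have hdisj : (fareyFractions n : Set (Σ _ : ℕ, ℕ)).PairwiseDisjoint
      fun x => newPairs n ((x.2 / x.1 : ℚ) : ℝ) := by
    intro x hx y hy hxy
    have hne : (x.2 / x.1 : ℚ) ≠ y.2 / y.1 := by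
      intro he
      obtain ⟨-, -, hx1, hx2, -⟩ := mem_fareyFractions hx
      obtain ⟨-, -, hy1, hy2, -⟩ := mem_fareyFractions hy
      rw [he] at hx1 hx2
      have e1 : x.1 = y.1 := by omega
      have e2 : x.2 = y.2 := by omega
      obtain ⟨p, a⟩ := x
      obtain ⟨p', a'⟩ := y
      simp only at e1 e2
      subst e1 e2
      exact hxy rfl
    rcases lt_or_gt_of_ne hne with h | h
    · exact disjoint_newPairs (by exact_mod_cast h)
    · exact (disjoint_newPairs (by exact_mod_cast h)).symm
  rw [fPairs, hU, (Finset.finite_toSet _).ncard_biUnion (fun _ _ => Set.toFinite _) hdisj,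
    finsum_mem_coe_finset]

theorem mainTheorem4 (n : ℕ) (hn : 1 ≤ n) :
    (fPairs n : ℚ) = (n : ℚ) * ((n : ℚ) + 1) +
      (1 / 2 : ℚ) * ∑ p ∈ Finset.Icc 3 n,
        (Nat.totient p : ℚ) * ((n : ℚ) ^ 2 - (p : ℚ) ^ 2 + (n : ℚ) + (p : ℚ)) := by
  have hsum : (fPairs n : ℚ) = ∑ p ∈ Finset.Icc 1 n,
      ((fareyNumerators p).card : ℚ) * (((n : ℚ) + 1) * n - p * (p - 1)) := by
    rw [fPairs_eq_sum hn, Nat.cast_sum]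
    have : ∀ x ∈ fareyFractions n, ((newPairs n ((x.2 / x.1 : ℚ) : ℝ)).ncard : ℚ)
        = ((n : ℚ) + 1) * n - x.1 * (x.1 - 1) := by
      intro x hx
      obtain ⟨h0, h1, hd, -, hle⟩ := mem_fareyFractions hx
      rw [ncard_newPairs h0 (h1.trans (by norm_num)) (by omega), hd]
    rw [Finset.sum_congr rfl this, fareyFractions, Finset.sum_sigma]
    simp [mul_sub]
  -- The fraction $0/1$ contributes the term $n(n+1)$. Denominator 2 contributes nothing, as $1/2$
  -- is excluded, so the sum starts at 3.
  have c1 : (fareyNumerators 1).card = 1 := by decide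
  have c2 : (fareyNumerators 2).card = 0 := by decide
  have hsub : Finset.Icc 3 n ⊆ Finset.Icc 2 n := Finset.Icc_subset_Icc (by norm_num) le_rfl
  rw [hsum, ← Finset.add_sum_Ioc_eq_sum_Icc hn, c1]
  have e : Finset.Ioc 1 n = Finset.Icc 2 n := by ext; simp; omega
  rw [e, ← Finset.sum_subset hsub, Finset.mul_sum]
  · congr 1
    · push_cast; ring
    · refine Finset.sum_congr rfl fun p hp => ?_
      have h : (2 : ℚ) * (fareyNumerators p).card = p.totient := by
        exact_mod_cast card_fareyNumerators (Finset.mem_Icc.1 hp).1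
      rw [← h]
      ring
  · intro p hp hp'
    simp only [Finset.mem_Icc] at hp hp'
    obtain rfl : p = 2 := by omega
    simp [c2]
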